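/- Let $q\ge 0$ be an integer and let $\Lambda$ be a commutative ring with $1$; if $q\ge 1$, assume that $\Lambda$ is $q$-torsion-free, i.e. $qa=0$ implies $a=0$ for $a\in\Lambda$. All Lie algebras are Lie algebras over $\Lambda$ (so $[x,x]=0$ for all $x$). For a Lie algebra $\mathfrak g$, let $\mathfrak g\otimes^q\mathfrak g$ be the Lie algebra generated by symbols $g\otimes h$ and, if $q\ge 1$, also $\{g\}$ $(g,h\in\mathfrak g)$, subject to the following relations for all $g,g',h,h'\in\mathfrak g$ and $\lambda,\lambda'\in\Lambda$: \begin{align*} &\lambda(h\otimes g)=\lambda h\otimes g=h\otimes\lambda g,\\ &(h+h')\otimes g=h\otimes g+h'\otimes g,\qquad h\otimes(g+g')=h\otimes g+h\otimes g',\\ &[h,h']\otimes g=h\otimes[h',g]-h'\otimes[h,g],\qquad h\otimes[g,g']=[g',h]\otimes g-[g,h]\otimes g',\\ &[h\otimes g,h'\otimes g']=[h,g]\otimes[h',g'], \end{align*} and, if $q\ge1$, also \begin{align*} &[\{h'\},h\otimes g]=[qh',h]\otimes g+h\otimes[qh',g],\qquad \{\lambda h+\lambda'h'\}=\lambda\{h\}+\lambda'\{h'\},\\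 &[\{h\},\{h'\}]=qh\otimes qh',\qquad \{[h,g]\}=q(h\otimes g). \end{align*} Let $\mathfrak g\wedge^q\mathfrak g$ be the quotient of $\mathfrak g\otimes^q\mathfrak g$ by the relations $h\otimes h=0$ $(h\in\mathfrak g)$, let $g\wedge h$ be the image of $g\otimes h$, and put $$Z^{\curlywedge}_q(\mathfrak g)=\{g\in\mathfrak g : g\wedge x=0 \text{ in } \mathfrak g\wedge^q\mathfrak g \text{ for all } x\in\mathfrak g\}.$$ For a Lie algebra $\mathfrak m$ let $Z(\mathfrak m)$ be its center and $Z_q(\mathfrak m)=\{e\in Z(\mathfrak m): qe=0\}$. A Lie algebra $\mathfrak g$ is called strongly $q$-capable if there is a Lie algebra $\mathfrak m$ with $Z(\mathfrak m)=Z_q(\mathfrak m)$ and $\mathfrak g\cong\mathfrak m/Z(\mathfrak m)$. **Theorem.** A Lie algebra $\mathfrak g$ is strongly $q$-capable if and only if $Z^{\curlywedge}_q(\mathfrak g)=\{0\}$. -/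

import Mathlib

universe u v w

noncomputable section

namespace QLie

/-- The generating symbols of the non-abelian `q`-tensor square of `L`: the symbols `x ⊗ y`,
and, only when `q ≥ 1`, the symbols `{x}`. -/
inductive TensorGen (q : ℕ) (L : Type v) : Type v
  | tmul (x y : L) : TensorGen q L
  | curly (hq : q ≠ 0) (x : L) : TensorGen q L

section

variable (R : Type u) [CommRing R] (q : ℕ) (L : Type v) [LieRing L] [LieAlgebra R L]

/-- The symbol `x ⊗ y` in the free Lie algebra on the generating symbols. -/
def preTmul (x y : L) : FreeLieAlgebra R (TensorGen q L) :=
  FreeLieAlgebra.of R (TensorGen.tmul x y)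

/-- The symbol `{x}` in the free Lie algebra on the generating symbols (for `q ≥ 1`). -/
def preCurly (hq : q ≠ 0) (x : L) : FreeLieAlgebra R (TensorGen q L) :=
  FreeLieAlgebra.of R (TensorGen.curly hq x)

/-- The defining relations of the non-abelian `q`-tensor square `L ⊗^q L`. Those that involve
the symbols `{x}` are present only for `q ≥ 1`. -/
inductive TensorRel :
    FreeLieAlgebra R (TensorGen q L) → FreeLieAlgebra R (TensorGen q L) → Prop
  | smul_left (a : R) (x y : L) :
      TensorRel (a • preTmul R q L x y) (preTmul R q L (a • x) y)
  | smul_right (a : R) (x y : L) :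
      TensorRel (a • preTmul R q L x y) (preTmul R q L x (a • y))
  | add_left (x x' y : L) :
      TensorRel (preTmul R q L (x + x') y) (preTmul R q L x y + preTmul R q L x' y)
  | add_right (x y y' : L) :
      TensorRel (preTmul R q L x (y + y')) (preTmul R q L x y + preTmul R q L x y')
  | lie_left (x x' y : L) :
      TensorRel (preTmul R q L ⁅x, x'⁆ y)
        (preTmul R q L x ⁅x', y⁆ - preTmul R q L x' ⁅x, y⁆)
  | lie_right (x y y' : L) :
      TensorRel (preTmul R q L x ⁅y, y'⁆)
        (preTmul R q L ⁅y', x⁆ y - preTmul R q L ⁅y, x⁆ y')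
  | lie_tmul_tmul (x y x' y' : L) :
      TensorRel ⁅preTmul R q L x y, preTmul R q L x' y'⁆ (preTmul R q L ⁅x, y⁆ ⁅x', y'⁆)
  | lie_curly_tmul (hq : q ≠ 0) (z x y : L) :
      TensorRel ⁅preCurly R q L hq z, preTmul R q L x y⁆
        (preTmul R q L ⁅q • z, x⁆ y + preTmul R q L x ⁅q • z, y⁆)
  | curly_linear (hq : q ≠ 0) (a a' : R) (x x' : L) :
      TensorRel (preCurly R q L hq (a • x + a' • x'))
        (a • preCurly R q L hq x + a' • preCurly R q L hq x')
  | lie_curly_curly (hq : q ≠ 0) (x x' : L) :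
      TensorRel ⁅preCurly R q L hq x, preCurly R q L hq x'⁆
        (preTmul R q L (q • x) (q • x'))
  | curly_lie (hq : q ≠ 0) (x y : L) :
      TensorRel (preCurly R q L hq ⁅x, y⁆) (q • preTmul R q L x y)

/-- The Lie ideal generated by the defining relations of `L ⊗^q L`. -/
def tensorIdeal : LieIdeal R (FreeLieAlgebra R (TensorGen q L)) :=
  LieSubmodule.lieSpan R (FreeLieAlgebra R (TensorGen q L))
    {z | ∃ s t, TensorRel R q L s t ∧ z = s - t}

/-- The non-abelian `q`-tensor square `L ⊗^q L`: the Lie algebra given by the generators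
`TensorGen q L` and the relations `TensorRel R q L`. -/
abbrev TensorSquare : Type (max u v) :=
  FreeLieAlgebra R (TensorGen q L) ⧸ tensorIdeal R q L

/-- The element `x ⊗ y` of `L ⊗^q L`. -/
def tmul (x y : L) : TensorSquare R q L :=
  LieSubmodule.Quotient.mk (N := tensorIdeal R q L) (preTmul R q L x y)

/-- The Lie ideal of `L ⊗^q L` generated by the elements `x ⊗ x`. -/
def diagonalIdeal : LieIdeal R (TensorSquare R q L) :=
  LieSubmodule.lieSpan R (TensorSquare R q L) (Set.range fun x : L => tmul R q L x x)

/-- The non-abelian `q`-exterior square `L ∧^q L`. -/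
abbrev ExteriorSquare : Type (max u v) :=
  TensorSquare R q L ⧸ diagonalIdeal R q L

/-- The element `x ∧ y` of `L ∧^q L`, the coset of `x ⊗ y`. -/
def wedge (x y : L) : ExteriorSquare R q L :=
  LieSubmodule.Quotient.mk (N := diagonalIdeal R q L) (tmul R q L x y)

variable {L}

theorem wedge_eq_of_rel {s t : FreeLieAlgebra R (TensorGen q L)} (h : TensorRel R q L s t) :
    LieSubmodule.Quotient.mk (N := diagonalIdeal R q L)
        (LieSubmodule.Quotient.mk (N := tensorIdeal R q L) s) =
      LieSubmodule.Quotient.mk (N := diagonalIdeal R q L)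
        (LieSubmodule.Quotient.mk (N := tensorIdeal R q L) t) := by
  congr 1
  refine (Submodule.Quotient.eq _).2 ?_
  exact LieSubmodule.subset_lieSpan ⟨s, t, h, rfl⟩

theorem wedge_add_left (x x' y : L) :
    wedge R q L (x + x') y = wedge R q L x y + wedge R q L x' y :=
  wedge_eq_of_rel R q (TensorRel.add_left x x' y)

theorem wedge_smul_left (a : R) (x y : L) :
    wedge R q L (a • x) y = a • wedge R q L x y :=
  (wedge_eq_of_rel R q (TensorRel.smul_left a x y)).symm

variable (L)

/-- The `q`-exterior center of `L` in the sense of Ellis: all `g` in `L` with `g ∧ x = 0`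
in `L ∧^q L` for every `x` in `L`. -/
def ellisExteriorCenter : Submodule R L where
  carrier := {g | ∀ x : L, wedge R q L g x = 0}
  zero_mem' := fun x => by
    have h := wedge_smul_left R q (0 : R) (0 : L) x
    rwa [zero_smul, zero_smul] at h
  add_mem' := fun {a b} ha hb x => by
    rw [wedge_add_left, ha x, hb x, add_zero]
  smul_mem' := fun c a ha x => by
    rw [wedge_smul_left, ha x, smul_zero]

/-- The `q`-center of `L`: all central elements `e` with `q e = 0`. -/
def qCenter : LieIdeal R L where
  carrier := {e | e ∈ LieAlgebra.center R L ∧ q • e = 0}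
  zero_mem' := ⟨zero_mem _, smul_zero _⟩
  add_mem' := fun {a b} ha hb =>
    ⟨add_mem ha.1 hb.1, by rw [smul_add, ha.2, hb.2, add_zero]⟩
  smul_mem' := fun c a ha =>
    ⟨(LieAlgebra.center R L).smul_mem c ha.1, by rw [smul_comm, ha.2, smul_zero]⟩
  lie_mem := fun {x m} hm =>
    ⟨(LieAlgebra.center R L).lie_mem hm.1, by rw [← lie_nsmul, hm.2, lie_zero]⟩

/-- `L` is strongly `q`-capable (`q`-capable in the sense of Ellis): `L ≅ M / Z(M)` for some
Lie algebra `M` over the same ring with `Z(M) = Z_q(M)`. -/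
def IsStronglyCapable : Prop :=
  ∃ (M : Type w) (_ : LieRing M) (_ : LieAlgebra R M),
    LieAlgebra.center R M = qCenter R q M ∧
      Nonempty (L ≃ₗ⁅R⁆ (M ⧸ LieAlgebra.center R M))

end

end QLie

end

/-! If `f : M → L` is onto with kernel central and killed by `q`, then brackets and `q`-multiples in
`M` depend only on images in `L`. So `x ∧ y ↦ ⁅a, b⁆`, `{x} ↦ q • a`, for lifts `a`, `b` of `x`,
`y`, is a homomorphism (`exists_hom_of_ker_le_qCenter`). An element whose image lies in the exterior
center is then central.

Conversely, the bracket of `L` lifts to the wedge product. To make this lift the bracket of an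
extension whose kernel is killed by `q`, take a free module `P` with `p : P → L` onto and push out
multiplication by `q` on `P` along `z ↦ {p z}`. Torsion-freeness of `R` keeps the wedges embedded,
so a trivial exterior center makes the new center exactly the kernel
(`isStronglyCapable_of_cocycle`). -/

noncomputable section

namespace LieIdeal

variable {R L L' : Type*} [CommRing R] [LieRing L] [LieAlgebra R L] [LieRing L'] [LieAlgebra R L']

/-- The homomorphism of Lie algebras out of a quotient induced by one that vanishes on the ideal. -/
def quotientLift (I : LieIdeal R L) (f : L →ₗ⁅R⁆ L') (h : I ≤ f.ker) : L ⧸ I →ₗ⁅R⁆ L' :=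
  { I.toSubmodule.liftQ (f : L →ₗ[R] L') (fun x hx => f.mem_ker.1 (h hx)) with
    map_lie' := by
      rintro ⟨x⟩ ⟨y⟩
      exact f.map_lie x y }

theorem quotientLift_mk (I : LieIdeal R L) (f : L →ₗ⁅R⁆ L') (h : I ≤ f.ker) (x : L) :
    I.quotientLift f h (LieSubmodule.Quotient.mk x) = f x :=
  rfl

end LieIdeal

namespace QLie

section Exterior

variable (R : Type u) [CommRing R] (q : ℕ) (L : Type v) [LieRing L] [LieAlgebra R L]

/-- The image of the symbol `{x}` in the `q`-exterior square. -/
def curly (hq : q ≠ 0) (x : L) : ExteriorSquare R q L :=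
  LieSubmodule.Quotient.mk (N := diagonalIdeal R q L)
    (LieSubmodule.Quotient.mk (N := tensorIdeal R q L) (preCurly R q L hq x))

variable {L}

theorem wedge_add_right (x y y' : L) :
    wedge R q L x (y + y') = wedge R q L x y + wedge R q L x y' :=
  wedge_eq_of_rel R q (TensorRel.add_right x y y')

theorem wedge_smul_right (a : R) (x y : L) :
    wedge R q L x (a • y) = a • wedge R q L x y :=
  (wedge_eq_of_rel R q (TensorRel.smul_right a x y)).symm

theorem wedge_lie_left (x x' y : L) :
    wedge R q L ⁅x, x'⁆ y = wedge R q L x ⁅x', y⁆ - wedge R q L x' ⁅x, y⁆ :=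
  wedge_eq_of_rel R q (TensorRel.lie_left x x' y)

theorem wedge_self (x : L) : wedge R q L x x = 0 :=
  LieSubmodule.Quotient.mk_eq_zero'.2 (LieSubmodule.subset_lieSpan ⟨x, rfl⟩)

theorem curly_linear (hq : q ≠ 0) (a a' : R) (x x' : L) :
    curly R q L hq (a • x + a' • x') = a • curly R q L hq x + a' • curly R q L hq x' :=
  wedge_eq_of_rel R q (TensorRel.curly_linear hq a a' x x')

theorem curly_lie (hq : q ≠ 0) (x y : L) : curly R q L hq ⁅x, y⁆ = q • wedge R q L x y :=
  wedge_eq_of_rel R q (TensorRel.curly_lie hq x y)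

variable (L)

/-- The exterior product as a bilinear map. -/
def wedgeHom : L →ₗ[R] L →ₗ[R] ExteriorSquare R q L :=
  LinearMap.mk₂ R (wedge R q L) (wedge_add_left R q) (wedge_smul_left R q)
    (wedge_add_right R q) (wedge_smul_right R q)

/-- The linear map `x ↦ {x}` into the `q`-exterior square, read as `0` when `q = 0`. -/
def curlyHom : L →ₗ[R] ExteriorSquare R q L :=
  if hq : q = 0 then 0 else
    { toFun := curly R q L hq
      map_add' := fun x y => by simpa using curly_linear R q hq (1 : R) 1 x y
      map_smul' := fun a x => by simpa using curly_linear R q hq a 0 x 0 }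

variable {L}

theorem curlyHom_lie (x y : L) : curlyHom R q L ⁅x, y⁆ = q • wedge R q L x y := by
  by_cases hq : q = 0
  · simp [curlyHom, hq]
  · simpa [curlyHom, hq] using curly_lie R q hq x y

/-! ### Homomorphisms induced by extensions with kernel in the `q`-center. -/

variable {M : Type w} [LieRing M] [LieAlgebra R M]

/-- A Lie algebra homomorphism onto `L` whose kernel consists of central elements killed by `q`
induces a homomorphism from the `q`-exterior square of `L`. -/
theorem exists_hom_of_ker_le_qCenter (f : M →ₗ⁅R⁆ L) (hf : Function.Surjective f)
    (hker : ∀ m, f m = 0 → m ∈ qCenter R q M) :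
    ∃ F : ExteriorSquare R q L →ₗ⁅R⁆ M,
      (∀ a b, F (wedge R q L (f a) (f b)) = ⁅a, b⁆) ∧
      ∀ hq a, F (curly R q L hq (f a)) = q • a := by
  obtain ⟨s, hs⟩ := hf.hasRightInverse
  have hs : ∀ x, f (s x) = x := hs
  have hcen : ∀ {m m' : M}, f m = f m' → ∀ n : M, ⁅n, m⁆ = ⁅n, m'⁆ := fun {m m'} h n => by
    have := (hker (m - m') (by rw [map_sub, h, sub_self])).1
    rw [LieModule.mem_maxTrivSubmodule] at this
    rw [← sub_eq_zero, ← lie_sub, this n]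
  have hlie : ∀ {a a' b b' : M}, f a = f a' → f b = f b' → ⁅a, b⁆ = ⁅a', b'⁆ :=
    fun {a a' b b'} ha hb => by
      rw [hcen hb, ← lie_skew, hcen ha, lie_skew]
  have hsmul : ∀ {a a' : M}, f a = f a' → q • a = q • a' := fun {a a'} h => by
    have := (hker (a - a') (by rw [map_sub, h, sub_self])).2
    rw [← sub_eq_zero, ← smul_sub, this]
  -- The section `s` is only a map of sets; `hlie` and `hsmul` make these values independent of it,
  -- so each relation can be checked on convenient lifts.
  let g : TensorGen q L → M
    | .tmul x y => ⁅s x, s y⁆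
    | .curly _ x => q • s x
  let G := FreeLieAlgebra.lift R g
  have ht : ∀ x y, G (preTmul R q L x y) = ⁅s x, s y⁆ := fun x y =>
    FreeLieAlgebra.lift_of_apply g _
  have hc : ∀ hq x, G (preCurly R q L hq x) = q • s x := fun hq x =>
    FreeLieAlgebra.lift_of_apply g _
  have htf : ∀ {a b : M} {x y : L}, f a = x → f b = y → G (preTmul R q L x y) = ⁅a, b⁆ :=
    fun {a b x y} ha hb => (ht x y).trans (hlie ((hs x).trans ha.symm) ((hs y).trans hb.symm))
  have hrel : ∀ t t', TensorRel R q L t t' → G t = G t' := by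
    intro t t' h
    induction h with
    | smul_left a x y =>
      rw [map_smul, ht, ht, ← smul_lie]
      exact hlie (by simp [hs]) rfl
    | smul_right a x y =>
      rw [map_smul, ht, ht, ← lie_smul]
      exact hlie rfl (by simp [hs])
    | add_left x x' y =>
      rw [map_add, ht, ht, ht, ← add_lie]
      exact hlie (by simp [hs]) rfl
    | add_right x y y' =>
      rw [map_add, ht, ht, ht, ← lie_add]
      exact hlie rfl (by simp [hs])
    | lie_left x x' y =>
      rw [map_sub, htf (a := ⁅s x, s x'⁆) (b := s y) (by simp [hs]) (hs y),
        htf (a := s x) (b := ⁅s x', s y⁆) (hs x) (by simp [hs]),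
        htf (a := s x') (b := ⁅s x, s y⁆) (hs x') (by simp [hs]), lie_lie]
    | lie_right x y y' =>
      rw [map_sub, htf (a := s x) (b := ⁅s y, s y'⁆) (hs x) (by simp [hs]),
        htf (a := ⁅s y', s x⁆) (b := s y) (by simp [hs]) (hs y),
        htf (a := ⁅s y, s x⁆) (b := s y') (by simp [hs]) (hs y'),
        leibniz_lie, ← lie_skew (s y) ⁅s x, s y'⁆, ← lie_skew (s x) (s y),
        ← lie_skew (s x) (s y')]
      simp only [neg_lie]
      abel
    | lie_tmul_tmul x y x' y' =>
      rw [LieHom.map_lie, ht, ht, ht]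
      exact hlie (by simp [hs]) (by simp [hs])
    | lie_curly_tmul hq z x y =>
      rw [map_add, LieHom.map_lie, hc, ht,
        htf (a := ⁅q • s z, s x⁆) (b := s y) (by simp [hs]) (hs y),
        htf (a := s x) (b := ⁅q • s z, s y⁆) (hs x) (by simp [hs]), leibniz_lie]
    | curly_linear hq a a' x x' =>
      rw [map_add, map_smul, map_smul, hc, hc, hc, smul_comm a, smul_comm a', ← smul_add]
      exact hsmul (by simp [hs])
    | lie_curly_curly hq x x' =>
      rw [LieHom.map_lie, hc, hc, ht]
      exact hlie (by simp [hs]) (by simp [hs])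
    | curly_lie hq x y =>
      rw [map_nsmul, hc, ht]
      exact hsmul (by simp [hs])
  have hG : tensorIdeal R q L ≤ G.ker := by
    refine LieSubmodule.lieSpan_le.2 ?_
    rintro _ ⟨t, t', h, rfl⟩
    exact G.mem_ker.2 (by rw [map_sub, hrel t t' h, sub_self])
  let T := (tensorIdeal R q L).quotientLift G hG
  have hT : diagonalIdeal R q L ≤ T.ker := by
    refine LieSubmodule.lieSpan_le.2 ?_
    rintro _ ⟨x, rfl⟩
    exact T.mem_ker.2 ((ht x x).trans (lie_self _))
  exact ⟨(diagonalIdeal R q L).quotientLift T hT,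
    fun a b => htf rfl rfl, fun hq a => (hc hq _).trans (hsmul (hs _))⟩

theorem ellisExteriorCenter_eq_bot_of_isStronglyCapable
    (h : IsStronglyCapable.{u, v, w} R q L) : ellisExteriorCenter R q L = ⊥ := by
  obtain ⟨M, _, _, hM, ⟨e⟩⟩ := h
  let f : M →ₗ[R] L := e.symm.toLinearEquiv.toLinearMap ∘ₗ
    (LieSubmodule.Quotient.mk' (LieAlgebra.center R M) : M →ₗ[R] M ⧸ LieAlgebra.center R M)
  let f' : M →ₗ⁅R⁆ L :=
    { f with
      map_lie' := fun {x y} => by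
        exact e.symm.map_lie (LieSubmodule.Quotient.mk x) (LieSubmodule.Quotient.mk y) }
  have hf' : Function.Surjective f' :=
    e.symm.surjective.comp (LieSubmodule.Quotient.surjective_mk' _)
  have hker : ∀ m, f' m = 0 ↔ m ∈ LieAlgebra.center R M := fun m => by
    change e.symm (LieSubmodule.Quotient.mk m) = 0 ↔ _
    rw [← e.symm.coe_toLinearEquiv, LinearEquiv.map_eq_zero_iff]
    exact LieSubmodule.Quotient.mk_eq_zero'
  obtain ⟨F, hF, -⟩ := exists_hom_of_ker_le_qCenter R q f' hf'
    (fun m hm => hM ▸ (hker m).1 hm)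
  refine (Submodule.eq_bot_iff _).2 fun x hx => ?_
  obtain ⟨a, rfl⟩ := hf' x
  refine (hker a).2 ((LieModule.mem_maxTrivSubmodule _ _ _ _).2 fun b => ?_)
  rw [← lie_skew, ← hF a b, hx (f' b), map_zero, neg_zero]

/-! ### Construction of the extension. -/

/-- An `R`-module extension of `L` by a module killed by `q`, with a nondegenerate alternating
lift of the bracket of `L` satisfying the Jacobi identity, witnesses strong `q`-capability. -/
theorem isStronglyCapable_of_cocycle {M : Type w} [AddCommGroup M] [Module R M]
    (f : M →ₗ[R] L) (hf : Function.Surjective f) (B : L →ₗ[R] L →ₗ[R] M)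
    (hself : ∀ x, B x x = 0) (hfB : ∀ x y, f (B x y) = ⁅x, y⁆)
    (hjac : ∀ x y z, B ⁅x, y⁆ z = B x ⁅y, z⁆ - B y ⁅x, z⁆)
    (hker : ∀ m, f m = 0 → q • m = 0) (hnd : ∀ x, (∀ y, B x y = 0) → x = 0) :
    IsStronglyCapable.{u, v, w} R q L := by
  -- The bracket factors through `f`, so `ker f` is central; nondegeneracy gives the reverse
  -- inclusion.
  let _ : LieRing M :=
    { bracket := fun m n => B (f m) (f n)
      add_lie := fun x y z => by simp
      lie_add := fun x y z => by simp
      lie_self := fun x => hself _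
      leibniz_lie := fun x y z => by
        change B (f x) (f (B (f y) (f z))) =
          B (f (B (f x) (f y))) (f z) + B (f y) (f (B (f x) (f z)))
        rw [hfB, hfB, hfB, hjac, sub_add_cancel] }
  let _ : LieAlgebra R M :=
    { lie_smul := fun a x y => by
        change B (f x) (f (a • y)) = a • B (f x) (f y)
        simp }
  have hlie : ∀ m n : M, ⁅m, n⁆ = B (f m) (f n) := fun _ _ => rfl
  have hcenter : ∀ m, m ∈ LieAlgebra.center R M ↔ f m = 0 := fun m => by
    refine (LieModule.mem_maxTrivSubmodule _ _ _ _).trans ⟨fun h => hnd _ fun y => ?_, fun h n => ?_⟩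
    · obtain ⟨n, rfl⟩ := hf y
      rw [← hlie, ← lie_skew, h, neg_zero]
    · rw [hlie, h, map_zero]
  let f' : M →ₗ⁅R⁆ L := { f with map_lie' := fun {x y} => hfB _ _ }
  let e := (LieAlgebra.center R M).quotientLift f' fun m hm => f'.mem_ker.2 ((hcenter m).1 hm)
  have he : Function.Bijective e := by
    refine ⟨(injective_iff_map_eq_zero e).2 ?_, fun x => ?_⟩
    · rintro ⟨m⟩ hm
      exact LieSubmodule.Quotient.mk_eq_zero'.2 ((hcenter m).2 hm)
    · obtain ⟨m, rfl⟩ := hf x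
      exact ⟨LieSubmodule.Quotient.mk m, rfl⟩
  refine ⟨M, inferInstance, inferInstance, ?_, ⟨(LieEquiv.ofBijective e he).symm⟩⟩
  ext m
  exact ⟨fun h => ⟨h, hker m ((hcenter m).1 h)⟩, fun h => h.1⟩

theorem isStronglyCapable_of_ellisExteriorCenter_eq_bot
    (hR : q ≠ 0 → ∀ a : R, q • a = 0 → a = 0) (h : ellisExteriorCenter R q L = ⊥) :
    IsStronglyCapable.{u, v, max u v w} R q L := by
  obtain ⟨F, hFw, hFc⟩ := exists_hom_of_ker_le_qCenter R q (LieHom.id : L →ₗ⁅R⁆ L)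
    Function.surjective_id (by rintro _ rfl; exact zero_mem _)
  have hFκ : ∀ x, F (curlyHom R q L x) = q • x := fun x => by
    by_cases hq : q = 0
    · simp [curlyHom, hq]
    · simpa [curlyHom, hq] using hFc hq x
  -- On this span `w ↦ {F w}` is multiplication by `q`: `{[x, y]} = q (x ∧ y)` and `{q x} = q {x}`,
  -- and both sides are linear.
  let W : Submodule R (ExteriorSquare R q L) :=
    Submodule.span R ({w | ∃ x y, wedge R q L x y = w} ∪ Set.range (curlyHom R q L))
  have hqW : ∀ w ∈ W, curlyHom R q L (F w) = q • w := by
    intro w hw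
    induction hw using Submodule.span_induction with
    | mem w hw =>
      rcases hw with ⟨x, y, rfl⟩ | ⟨x, rfl⟩
      · exact (congrArg _ (hFw x y)).trans (curlyHom_lie R q x y)
      · rw [hFκ, map_nsmul]
    | zero => simp
    | add x y _ _ hx hy => rw [map_add, map_add, hx, hy, smul_add]
    | smul a x _ hx => rw [map_smul, map_smul, hx, smul_comm]
  let κ : L →ₗ[R] W := (curlyHom R q L).codRestrict W fun x =>
    Submodule.subset_span (Or.inr ⟨x, rfl⟩)
  let B : L →ₗ[R] L →ₗ[R] W := LinearMap.mk₂ R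
    (fun x y => ⟨wedge R q L x y, Submodule.subset_span (Or.inl ⟨x, y, rfl⟩)⟩)
    (fun x x' y => Subtype.ext (wedge_add_left R q x x' y))
    (fun a x y => Subtype.ext (wedge_smul_left R q a x y))
    (fun x y y' => Subtype.ext (wedge_add_right R q x y y'))
    (fun a x y => Subtype.ext (wedge_smul_right R q a x y))
  let d : W →ₗ[R] L := (F : ExteriorSquare R q L →ₗ[R] L) ∘ₗ W.subtype
  let p : (L →₀ R) →ₗ[R] L := Finsupp.linearCombination R id
  -- Modulo `S`, `q (z, 0) = (0, {p z})`. Using `L` itself in place of the free module would kill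
  -- `{x}` whenever `q x = 0`.
  let S : Submodule R ((L →₀ R) × W) :=
    LinearMap.range ((q • LinearMap.id).prod (-(κ ∘ₗ p)))
  have hdκ : ∀ x, d (κ x) = q • x := hFκ
  have hκd : ∀ w, κ (d w) = q • w := fun w => Subtype.ext (hqW w w.2)
  have hS : S ≤ LinearMap.ker (p.coprod d) := by
    rintro _ ⟨z, rfl⟩
    simp [hdκ]
  let ι : W →ₗ[R] ((L →₀ R) × W) ⧸ S := S.mkQ ∘ₗ LinearMap.inr R (L →₀ R) W
  have hι : ∀ w, ι w = 0 → w = 0 := by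
    intro w hw
    obtain ⟨z, hz⟩ := (Submodule.Quotient.mk_eq_zero S).1 hw
    have h1 : q • z = 0 := congrArg Prod.fst hz
    have h2 : -κ (p z) = w := congrArg Prod.snd hz
    rw [← h2, neg_eq_zero]
    -- For `q = 0` the element `z` is arbitrary but `κ` vanishes; otherwise the free module has no
    -- `q`-torsion.
    by_cases hq : q = 0
    · exact Subtype.ext (by simp [κ, curlyHom, hq])
    · have : z = 0 := Finsupp.ext fun x => hR hq _ (by simpa using DFunLike.congr_fun h1 x)
      rw [this, map_zero, map_zero]
  -- Only adjusts the universe of the witness.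
  let E := ULift.moduleEquiv.{u, max u v, w} (R := R) (M := ((L →₀ R) × W) ⧸ S)
  refine isStronglyCapable_of_cocycle R q (S.liftQ (p.coprod d) hS ∘ₗ E.toLinearMap) ?_
    (B.compr₂ (E.symm.toLinearMap ∘ₗ ι)) ?_ ?_ ?_ ?_ ?_
  · intro x
    refine ⟨E.symm (S.mkQ (Finsupp.single x 1, 0)), ?_⟩
    simp [p]
  · intro x
    have : B x x = 0 := Subtype.ext (wedge_self R q x)
    simp [this]
  · intro x y
    have : d (B x y) = ⁅x, y⁆ := hFw x y
    simp [ι, this]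
  · intro x y z
    have : B ⁅x, y⁆ z = B x ⁅y, z⁆ - B y ⁅x, z⁆ := Subtype.ext (wedge_lie_left R q x y z)
    simp [this]
  · intro m hm
    obtain ⟨⟨z, w⟩, hzw⟩ := S.mkQ_surjective (E m)
    have hm : S.liftQ (p.coprod d) hS (E m) = 0 := hm
    apply E.injective
    rw [map_nsmul, map_zero, ← hzw, ← map_nsmul]
    -- From `p z = -d w` one gets `-κ (p z) = κ (d w) = q w`, so `q (z, w)` is the element of `S`
    -- given by `z`.
    refine (Submodule.Quotient.mk_eq_zero S).2 ⟨z, ?_⟩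
    have hpd : p z + d w = 0 := by simpa [← hzw] using hm
    refine Prod.ext rfl ?_
    change -κ (p z) = q • w
    rw [← hκd, eq_neg_of_add_eq_zero_left hpd, map_neg, neg_neg]
  · intro x hx
    have : x ∈ ellisExteriorCenter R q L := fun y => by
      have h0 := hι (B x y) (by simpa using hx y)
      exact congrArg Subtype.val h0
    rwa [h, Submodule.mem_bot] at this

end Exterior

end QLie

end

/- The universe of the witness `M` may be any one that contains those of `R` and `L`. -/
theorem theorem6p7 (R : Type u) [CommRing R] (q : ℕ)
    (hR : q ≠ 0 → ∀ a : R, q • a = 0 → a = 0)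
    (L : Type v) [LieRing L] [LieAlgebra R L] :
    QLie.IsStronglyCapable.{u, v, max u v w} R q L ↔
      QLie.ellisExteriorCenter R q L = ⊥ :=
  ⟨QLie.ellisExteriorCenter_eq_bot_of_isStronglyCapable R q,
    QLie.isStronglyCapable_of_ellisExteriorCenter_eq_bot.{u, v, w} R q hR⟩
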